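/- Let $G$ be a finite, nonempty simple graph. A \emph{broken cycle} of $G$ is a subgraph of the form $C-e$, where $C$ is a cycle of $G$ and $e$ is an edge of $C$. A coloring of the edges of $G$ (not necessarily proper) is \emph{strongly woody} if no broken cycle is monochromatic, and the \emph{strong arboricity} $\zeta(G)$ is the least number of colors in a strongly woody coloring of the edges of $G$. Corollary: if $G$ is cubic (that is, $3$-regular) and has girth at least $7$ (every cycle of $G$ has at least $7$ edges), then $\zeta(G)=2$. -/

import Mathlib

namespace SimpleGraph

variable {V : Type*} {G : SimpleGraph V}

/-- A broken cycle of `G` is a subgraph `C - e`, where `C` is a cycle of `G` and `e` is an edge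
of `C`. -/
def Subgraph.IsBrokenCycle (B : G.Subgraph) : Prop :=
  ∃ (v : V) (C : G.Walk v v), C.IsCycle ∧ ∃ e ∈ C.edges, B = C.toSubgraph.deleteEdges {e}

/-- A subgraph is monochromatic under an edge coloring `c` of `G` (not necessarily proper) if all
its edges get the same color. -/
def Subgraph.IsMonochromatic {K : Type*} (B : G.Subgraph) (c : G.EdgeLabeling K) : Prop :=
  ∀ e f : G.edgeSet, e.1 ∈ B.edgeSet → f.1 ∈ B.edgeSet → c e = c f

/-- An edge coloring of `G` is strongly woody if no broken cycle is monochromatic. -/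
def EdgeLabeling.IsStronglyWoody {K : Type*} (c : G.EdgeLabeling K) : Prop :=
  ∀ B : G.Subgraph, B.IsBrokenCycle → ¬ B.IsMonochromatic c

/-- The strong arboricity `ζ(G)`: the least number of colors in a strongly woody coloring of the
edges of `G` (and `⊤` if no finite number of colors is enough). -/
noncomputable def strongArboricity (G : SimpleGraph V) : ℕ∞ :=
  ⨅ n ∈ {n : ℕ | ∃ c : G.EdgeLabeling (Fin n), c.IsStronglyWoody}, (n : ℕ∞)

end SimpleGraph

namespace SimpleGraph

/-! ### Forests under attaching or isolating a vertex, and medians of leaves -/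

section General

variable {V : Type*} {M N : SimpleGraph V} {u : V}

/-! Color the vertices with two colors and label each edge by whether its ends agree. By the girth,
a broken cycle is a path with at least 6 edges whose ends are joined by the deleted edge. If all its
edges have agreeing ends, so does the deleted edge, and the cycle lies in `monoGraph`. Hence it
suffices that `monoGraph` is a forest and that no path with 6 edges alternates in color.

Both hold for a coloring of least `potential` among those whose `monoGraph` is a forest. Let p0,
..., p6 be an alternating path. The inner vertices have cross degree at least 2;
`IsOptimal.false_of_three` and `IsOptimal.reachable` force it to be exactly 2 and make p1, p3, p5
leaves of one tree of `monoGraph`. Their median m (`exists_median`) has cross degree 0, and flipping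
m separates the three leaves. Then flipping p2 or p4 as well keeps a forest and lowers the potential
(`IsOptimal.false_of_double_flip`). Neither choice would be available only if m were adjacent to
both p1 and p5, which would close a 6-cycle.

One color is not enough, because a finite nonempty cubic graph contains a cycle. -/

lemma Walk.reachable_of_notMem_support
    (h : ∀ x y, x ≠ u → y ≠ u → M.Adj x y → N.Adj x y) {a b : V} (w : M.Walk a b)
    (hw : u ∉ w.support) : N.Reachable a b := by
  induction w with
  | nil => rfl
  | @cons a c b hac w ih =>
    rw [Walk.support_cons, List.mem_cons, not_or] at hw
    have hc : c ≠ u := fun hc => hw.2 (hc ▸ w.start_mem_support)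
    exact (h a c (Ne.symm hw.1) hc hac).reachable.trans (ih hw.2)

/-- Attaching a vertex `u` to an acyclic graph, with at most one edge to each component, gives
an acyclic graph. -/
lemma IsAcyclic.of_attach_vertex (hM : M.IsAcyclic)
    (h : ∀ x y, x ≠ u → y ≠ u → N.Adj x y → M.Adj x y)
    (hu : ∀ x y, N.Adj u x → N.Adj u y → x ≠ y → ¬ M.Reachable x y) : N.IsAcyclic := by
  classical
  intro v C hC
  by_cases hv : u ∈ C.support
  · have hD := hC.rotate hv
    set D := C.rotate u hv
    have hDn : ¬ D.Nil := hD.not_nil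
    -- Dropping the first and last edges of the cycle based at `u` leaves a walk between two
    -- neighbors of `u` that avoids `u`, so its edges lie in `M`.
    refine hu D.snd D.penultimate (D.adj_snd hDn) (D.adj_penultimate hDn).symm
      hD.snd_ne_penultimate ?_
    have htail : D.tail.support = D.support.tail := D.support_tail_of_not_nil hDn
    have hlen := hD.three_le_length
    have hl : D.tail.length + 1 = D.length := D.length_tail_add_one hDn
    have htn : ¬ D.tail.Nil := by
      rw [← Walk.length_eq_zero_iff]; omega
    have hp : D.tail.penultimate = D.penultimate := by
      simp only [Walk.penultimate, Walk.getVert_tail]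
      congr 1; omega
    have hnd := hD.isPath_tail.support_nodup
    rw [← Walk.support_dropLast_concat htn] at hnd
    have hnot : u ∉ D.tail.dropLast.support := by
      intro hmem
      exact (List.nodup_append.1 hnd).2.2 u hmem u (by simp) rfl
    rw [← hp]
    exact Walk.reachable_of_notMem_support h D.tail.dropLast hnot
  · have key : ∀ e ∈ C.edges, e ∈ M.edgeSet := by
      intro e he
      induction e with | _ x y =>
      have hx := C.fst_mem_support_of_mem_edges he
      have hy := C.snd_mem_support_of_mem_edges he
      exact h x y (fun h => hv (h ▸ hx)) (fun h => hv (h ▸ hy)) (C.adj_of_mem_edges he)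
    exact hM _ (hC.transfer key)

/-- In an acyclic graph, deleting a vertex separates its neighbors. -/
lemma IsAcyclic.not_reachable_of_isolated (hM : M.IsAcyclic) (hNM : N ≤ M)
    (hu : ∀ x, ¬ N.Adj u x) {x y : V} (hx : M.Adj u x) (hy : M.Adj u y) (hxy : x ≠ y) :
    ¬ N.Reachable x y := by
  classical
  intro ⟨w⟩
  have hux : ∀ {a b : V} (w : N.Walk a b), a ≠ u → u ∉ w.support := by
    intro a b w
    induction w with
    | nil => intro h; simpa using h.symm
    | @cons a c b hac w ih =>
      intro h
      have hc : c ≠ u := by rintro rfl; exact hu _ hac.symm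
      simpa [Walk.support_cons, h.symm] using ih hc
  let p : M.Path x y := ((w.mapLe hNM).toPath)
  have hp : u ∉ p.1.support := by
    intro hmem
    have := (w.mapLe hNM).support_toPath_subset_support hmem
    rw [Walk.support_mapLe_eq_support] at this
    exact hux w hx.ne' this
  let q : M.Path x y := ⟨Walk.cons hx.symm (Walk.cons hy Walk.nil), by
    simp [Walk.cons_isPath_iff, hx.ne', hy.ne, hxy]⟩
  have : p = q := (hM.subsingleton_path x y).elim p q
  exact hp (this ▸ by simp [q])

lemma isAcyclic_of_subsingleton_neighbors (h : ∀ v x y, M.Adj v x → M.Adj v y → x = y) :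
    M.IsAcyclic := fun _ C hC =>
  hC.snd_ne_penultimate <| h _ _ _ (C.adj_snd hC.not_nil) (C.adj_penultimate hC.not_nil).symm

lemma Reachable.exists_adj_dist_add_one {a b : V} (h : M.Reachable a b) (hab : a ≠ b) :
    ∃ x, M.Adj b x ∧ M.dist a x + 1 = M.dist a b := by
  obtain ⟨w, hw⟩ := h.exists_walk_length_eq_dist
  have hn : ¬ w.Nil := fun hn => hab hn.eq
  refine ⟨w.penultimate, (w.adj_penultimate hn).symm, ?_⟩
  have h1 := dist_le w.dropLast
  have h2 := Walk.length_dropLast_add_one hn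
  have h3 := (w.adj_penultimate hn).reachable.dist_triangle_right a
  rw [dist_eq_one_iff_adj.2 (w.adj_penultimate hn)] at h3
  omega

lemma Reachable.of_dist_lt (h : ∀ x y, x ≠ u → y ≠ u → M.Adj x y → N.Adj x y) {a b : V}
    (hab : M.Reachable a b) (hlt : M.dist a b < M.dist a u) : N.Reachable a b := by
  classical
  obtain ⟨w, hw⟩ := hab.exists_walk_length_eq_dist
  refine Walk.reachable_of_notMem_support h w fun hu => ?_
  have h1 := dist_le (w.takeUntil u hu)
  have h2 := w.length_takeUntil_le_length hu
  omega

/-- A median vertex of three leaves of a component. -/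
lemma exists_median [Finite V] {a : Fin 3 → V} (ha : Function.Injective a)
    (hr : ∀ i j, M.Reachable (a i) (a j)) (hleaf : ∀ i x y, M.Adj (a i) x → M.Adj (a i) y → x = y) :
    ∃ (m : V) (x : Fin 3 → V), Function.Injective x ∧ (∀ i, a i ≠ m) ∧ (∀ i, M.Adj m (x i)) ∧
      (∀ i, M.Reachable (a i) (x i)) ∧ ∀ i, M.dist (a i) (x i) + 1 = M.dist (a i) m := by
  classical
  have := Fintype.ofFinite V
  -- The median minimizes the total distance to the three leaves. No neighbor of it is closer to two
  -- of them, since the third distance grows by at most 1; at a leaf, the steps toward the other two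
  -- leaves would coincide.
  obtain ⟨m, hm, hmin⟩ := Finset.exists_min_image
    (Finset.univ.filter fun v => M.Reachable (a 0) v) (fun v => ∑ i, M.dist (a i) v)
    ⟨a 0, by simp⟩
  simp only [Finset.mem_filter, Finset.mem_univ, true_and] at hm hmin
  have hrm : ∀ i, M.Reachable (a i) m := fun i => (hr i 0).trans hm
  have hclose : ∀ i j x, i ≠ j → M.Adj m x → M.dist (a i) x + 1 = M.dist (a i) m →
      M.dist (a j) x + 1 = M.dist (a j) m → False := by
    intro i j x hij hx hi hj
    have h0 := hmin x (hm.trans hx.reachable)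
    have hle : ∀ k, M.dist (a k) x ≤ M.dist (a k) m + 1 := fun k => by
      have := hx.reachable.dist_triangle_right (a k)
      rwa [dist_eq_one_iff_adj.2 hx] at this
    have l0 := hle 0
    have l1 := hle 1
    have l2 := hle 2
    simp only [Fin.sum_univ_three] at h0
    fin_cases i <;> fin_cases j <;> simp at hij hi hj <;> omega
  have hne : ∀ i, a i ≠ m := by
    intro i hi
    obtain ⟨j, k, hj, hk, hjk⟩ : ∃ j k : Fin 3, j ≠ i ∧ k ≠ i ∧ j ≠ k :=
      (by decide : ∀ i : Fin 3, ∃ j k : Fin 3, j ≠ i ∧ k ≠ i ∧ j ≠ k) i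
    obtain ⟨x, hx, hx'⟩ := (hrm j).exists_adj_dist_add_one (hi ▸ ha.ne hj)
    obtain ⟨y, hy, hy'⟩ := (hrm k).exists_adj_dist_add_one (hi ▸ ha.ne hk)
    obtain rfl : x = y := hleaf i x y (hi ▸ hx) (hi ▸ hy)
    exact hclose j k x hjk hx hx' hy'
  choose x hx hx' using fun i => (hrm i).exists_adj_dist_add_one (hne i)
  refine ⟨m, x, ?_, hne, hx, fun i => (hrm i).trans (hx i).reachable, hx'⟩
  intro i j hij
  by_contra h
  exact hclose i j (x i) h (hx i) (hx' i) (hij ▸ hx' j)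

end General

end SimpleGraph

/-! ### Vertex 2-colorings, flips and cross degrees -/

namespace SimpleGraph

variable {V : Type*} {G : SimpleGraph V}

/-- The subgraph of edges of `G` whose ends get the same color under `f`. -/
def monoGraph (G : SimpleGraph V) (f : V → Bool) : SimpleGraph V where
  Adj x y := G.Adj x y ∧ f x = f y
  symm := ⟨fun _ _ h => ⟨h.1.symm, h.2.symm⟩⟩
  loopless := ⟨fun _ h => h.1.ne rfl⟩

lemma monoGraph_adj {f : V → Bool} {x y : V} :
    (G.monoGraph f).Adj x y ↔ G.Adj x y ∧ f x = f y := Iff.rfl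

lemma Reachable.color_eq {f : V → Bool} {x y : V} (h : (G.monoGraph f).Reachable x y) :
    f x = f y := by
  obtain ⟨w⟩ := h
  induction w with
  | nil => rfl
  | cons h _ ih => exact h.2.trans ih

/-- The vertices `a`, `b`, `c` are distinct and are precisely the neighbors of `u`. -/
structure IsNbrTriple (G : SimpleGraph V) (u a b c : V) : Prop where
  adj_iff : ∀ x, G.Adj u x ↔ x = a ∨ x = b ∨ x = c
  ne₁₂ : a ≠ b
  ne₁₃ : a ≠ c
  ne₂₃ : b ≠ c

namespace IsNbrTriple

variable {u a b c : V}

lemma adj₁ (h : G.IsNbrTriple u a b c) : G.Adj u a := (h.adj_iff a).2 (by simp)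
lemma adj₂ (h : G.IsNbrTriple u a b c) : G.Adj u b := (h.adj_iff b).2 (by simp)
lemma adj₃ (h : G.IsNbrTriple u a b c) : G.Adj u c := (h.adj_iff c).2 (by simp)

end IsNbrTriple

section Flip

variable [DecidableEq V]

/-- Change the color of the vertex `u`. -/
def flip (f : V → Bool) (u : V) : V → Bool := Function.update f u (!f u)

lemma flip_same (f : V → Bool) (u : V) : flip f u u = !f u := by simp [flip]

lemma flip_of_ne (f : V → Bool) {u v : V} (h : v ≠ u) : flip f u v = f v := by simp [flip, h]

lemma flip_comm (f : V → Bool) (u v : V) : flip (flip f u) v = flip (flip f v) u := by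
  rcases eq_or_ne u v with rfl | h
  · rfl
  · rw [flip, flip_of_ne _ h.symm, flip, flip, flip_of_ne _ h, flip, Function.update_comm h]

lemma monoGraph_flip_adj_of_ne {f : V → Bool} {u x y : V} (hx : x ≠ u) (hy : y ≠ u) :
    (G.monoGraph (flip f u)).Adj x y ↔ (G.monoGraph f).Adj x y := by
  simp [monoGraph_adj, flip_of_ne, hx, hy]

lemma monoGraph_flip_adj_self {f : V → Bool} {u x : V} :
    (G.monoGraph (flip f u)).Adj u x ↔ G.Adj u x ∧ f x ≠ f u := by
  simp only [monoGraph_adj, flip_same]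
  refine and_congr_right fun h => ?_
  rw [flip_of_ne _ h.ne']
  cases f x <;> cases f u <;> simp

lemma isAcyclic_monoGraph_flip {f : V → Bool} {u : V} (hf : (G.monoGraph f).IsAcyclic)
    (h : ∀ x y, G.Adj u x → f x ≠ f u → G.Adj u y → f y ≠ f u → x ≠ y →
      ¬ (G.monoGraph f).Reachable x y) : (G.monoGraph (flip f u)).IsAcyclic := by
  refine hf.of_attach_vertex (u := u) (fun x y hx hy => (monoGraph_flip_adj_of_ne hx hy).1) ?_
  intro x y hx hy
  rw [monoGraph_flip_adj_self] at hx hy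
  exact h x y hx.1 hx.2 hy.1 hy.2

end Flip

section Degree

variable [Fintype V] [DecidableRel G.Adj]

variable (G) in
/-- The number of neighbors of `v` whose color differs from that of `v`. -/
def crossDegree (f : V → Bool) (v : V) : ℕ :=
  (Finset.univ.filter fun y => G.Adj v y ∧ f y ≠ f v).card

lemma crossDegree_eq {f : V → Bool} {u a b c : V} (h : G.IsNbrTriple u a b c) :
    G.crossDegree f u =
      (if f a ≠ f u then 1 else 0) + (if f b ≠ f u then 1 else 0) + (if f c ≠ f u then 1 else 0) := by
  classical
  have h1 : (Finset.univ.filter fun y => G.Adj u y ∧ f y ≠ f u)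
      = ({a, b, c} : Finset V).filter fun y => f y ≠ f u := by
    ext y; simp [h.adj_iff]
  have h2 : ({a, b, c} : Finset V) = insert a (insert b {c}) := rfl
  rw [crossDegree, h1, Finset.card_filter, h2, Finset.sum_insert (by simp [h.ne₁₂, h.ne₁₃]),
    Finset.sum_insert (by simp [h.ne₂₃]), Finset.sum_singleton, add_assoc]

lemma IsRegularOfDegree.exists_isNbrTriple (hG : G.IsRegularOfDegree 3) {u a b : V}
    (ha : G.Adj u a) (hb : G.Adj u b) (hab : a ≠ b) : ∃ c, G.IsNbrTriple u a b c := by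
  classical
  have h1 := hG u
  rw [← card_neighborFinset_eq_degree] at h1
  have h2 : ((G.neighborFinset u \ {a, b})).card = 1 := by
    rw [Finset.card_sdiff_of_subset, h1, Finset.card_pair hab]
    intro x; simp only [Finset.mem_insert, Finset.mem_singleton, mem_neighborFinset]
    rintro (rfl | rfl) <;> assumption
  obtain ⟨c, hc⟩ := Finset.card_eq_one.1 h2
  have h3 : ∀ x, (G.Adj u x ∧ x ≠ a ∧ x ≠ b) ↔ x = c := fun x => by
    have := congrArg (x ∈ ·) hc
    simpa using this
  have h4 := (h3 c).2 rfl
  refine ⟨c, ⟨fun x => ?_, hab, h4.2.1.symm, h4.2.2.symm⟩⟩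
  have := h3 x
  constructor
  · intro hx
    by_cases x = a <;> by_cases x = b <;> simp_all
  · rintro (rfl | rfl | rfl)
    exacts [ha, hb, h4.1]

lemma IsRegularOfDegree.exists_isNbrTriple' (hG : G.IsRegularOfDegree 3) (u : V) :
    ∃ a b c, G.IsNbrTriple u a b c := by
  have h1 := hG u
  rw [← card_neighborFinset_eq_degree] at h1
  obtain ⟨a, ha, b, hb, hab⟩ := Finset.one_lt_card.1 (by omega : 1 < (G.neighborFinset u).card)
  rw [mem_neighborFinset] at ha hb
  obtain ⟨c, hc⟩ := hG.exists_isNbrTriple ha hb hab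
  exact ⟨a, b, c, hc⟩

/-- The neighbors of a vertex of cross degree 2: two of the other color, one of the same color. -/
lemma IsRegularOfDegree.exists_of_crossDegree_eq_two (hG : G.IsRegularOfDegree 3) {f : V → Bool}
    {u v v' : V} (h : G.crossDegree f u = 2) (hv : G.Adj u v) (hv' : G.Adj u v') (hne : v ≠ v')
    (hfv : f v ≠ f u) (hfv' : f v' ≠ f u) : ∃ t, G.IsNbrTriple u v v' t ∧ f t = f u := by
  obtain ⟨t, ht⟩ := hG.exists_isNbrTriple hv hv' hne
  rw [crossDegree_eq ht] at h
  refine ⟨t, ht, ?_⟩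
  by_contra hc
  simp [hfv, hfv', hc] at h

lemma IsRegularOfDegree.crossDegree_le (hG : G.IsRegularOfDegree 3) (f : V → Bool) (v : V) :
    G.crossDegree f v ≤ 3 := by
  obtain ⟨a, b, c, h⟩ := hG.exists_isNbrTriple' v
  rw [crossDegree_eq h]
  split_ifs <;> simp

lemma IsRegularOfDegree.color_ne_of_crossDegree_eq_three (hG : G.IsRegularOfDegree 3)
    {f : V → Bool} {u v : V} (h : G.crossDegree f u = 3) (hv : G.Adj u v) : f v ≠ f u := by
  obtain ⟨a, b, c, ht⟩ := hG.exists_isNbrTriple' u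
  rw [crossDegree_eq ht] at h
  rw [ht.adj_iff] at hv
  split_ifs at h with h1 h2 h3 <;> simp at h
  rcases hv with rfl | rfl | rfl <;> assumption

lemma color_eq_of_crossDegree_eq_zero {f : V → Bool} {u v : V}
    (h : G.crossDegree f u = 0) (hv : G.Adj u v) : f v = f u := by
  by_contra hc
  have := Finset.card_eq_zero.1 h
  have h2 : v ∈ (Finset.univ.filter fun y => G.Adj u y ∧ f y ≠ f u) := by simp [hv, hc]
  rw [this] at h2; simp at h2

lemma two_le_crossDegree {f : V → Bool} {u v w : V} (hv : G.Adj u v) (h : f v ≠ f u)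
    (hw : G.Adj u w) (h' : f w ≠ f u) (hvw : v ≠ w) :
    2 ≤ G.crossDegree f u :=
  Finset.one_lt_card.2 ⟨v, by simp [hv, h], w, by simp [hw, h'], hvw⟩

lemma IsRegularOfDegree.crossDegree_le_one (hG : G.IsRegularOfDegree 3) {f : V → Bool} {u v w : V}
    (hv : (G.monoGraph f).Adj u v) (hw : (G.monoGraph f).Adj u w) (hvw : v ≠ w) :
    G.crossDegree f u ≤ 1 := by
  obtain ⟨c, hc⟩ := hG.exists_isNbrTriple hv.1 hw.1 hvw
  rw [crossDegree_eq hc]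
  simp only [← hv.2, ← hw.2, ne_eq, not_true_eq_false, if_false]
  split_ifs <;> simp

lemma IsRegularOfDegree.crossDegree_le_two (hG : G.IsRegularOfDegree 3) {f : V → Bool} {u v : V}
    (hv : (G.monoGraph f).Adj u v) : G.crossDegree f u ≤ 2 := by
  by_contra h
  have h3 : G.crossDegree f u = 3 := by have := hG.crossDegree_le f u; omega
  exact hG.color_ne_of_crossDegree_eq_three h3 hv.1 hv.2.symm

variable [DecidableEq V]

lemma IsRegularOfDegree.crossDegree_flip_self (hG : G.IsRegularOfDegree 3) (f : V → Bool) (u : V) :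
    G.crossDegree (flip f u) u + G.crossDegree f u = 3 := by
  obtain ⟨a, b, c, h⟩ := hG.exists_isNbrTriple' u
  rw [crossDegree_eq h, crossDegree_eq h, flip_same, flip_of_ne _ h.adj₁.ne',
    flip_of_ne _ h.adj₂.ne', flip_of_ne _ h.adj₃.ne']
  cases f a <;> cases f b <;> cases f c <;> cases f u <;> simp

lemma crossDegree_flip_of_ne {f : V → Bool} {u v : V} (hv : G.Adj u v) (h : f v ≠ f u) :
    G.crossDegree (flip f u) v + 1 = G.crossDegree f v := by
  have hu : u ∈ Finset.univ.filter fun y => G.Adj v y ∧ f y ≠ f v := by simp [hv.symm, h.symm]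
  rw [crossDegree, crossDegree, ← Finset.card_erase_add_one hu]
  congr 2
  ext y
  rcases eq_or_ne y u with rfl | hy
  · simp only [flip_same, flip_of_ne _ hv.ne', Finset.mem_filter, Finset.mem_univ, true_and,
      Finset.mem_erase, ne_eq, not_true_eq_false, false_and, iff_false, not_and, not_not]
    cases hfv : f v <;> cases hfu : f y <;> simp_all
  · simp [flip_of_ne _ hv.ne', flip_of_ne _ hy, hy]

lemma crossDegree_flip_of_eq {f : V → Bool} {u v : V} (hv : G.Adj u v) (h : f v = f u) :
    G.crossDegree (flip f u) v = G.crossDegree f v + 1 := by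
  have := crossDegree_flip_of_ne (f := flip f u) hv (by rw [flip_same, flip_of_ne _ hv.ne', h]; simp)
  rw [← this]
  congr 2
  funext x
  rcases eq_or_ne x u with rfl | hx
  · simp [flip_same]
  · simp [flip_of_ne _ hx]

lemma crossDegree_flip_of_not_adj {f : V → Bool} {u v : V} (hv : ¬ G.Adj u v) (h : v ≠ u) :
    G.crossDegree (flip f u) v = G.crossDegree f v := by
  rw [crossDegree, crossDegree]
  congr 1
  refine Finset.filter_congr fun y _ => and_congr_right fun hy => ?_
  have : y ≠ u := by rintro rfl; exact hv hy.symm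
  rw [flip_of_ne _ this, flip_of_ne _ h]

end Degree

/-! ### The potential and its change under a flip -/

/-- The weight of a vertex in the potential, as a function of its cross degree. -/
def weight : ℕ → ℤ
  -- The values leave little slack: the tightest changes used are -2 in `IsOptimal.false_of_three`,
  -- -4 in `IsOptimal.of_not_reachable` and -1 in `IsOptimal.false_of_double_flip`.
  | 0 => 504
  | 1 => 0
  | 2 => 103
  | _ => 400

lemma sum_weight_eq [Fintype V] [DecidableEq V] {r s : V → ℕ} {u a b c : V} (h : G.IsNbrTriple u a b c)
    (hrs : ∀ v, v ≠ u → ¬ G.Adj u v → s v = r v) :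
    ∑ v, weight (s v) = ∑ v, weight (r v) + (weight (s u) - weight (r u)) +
      (weight (s a) - weight (r a)) + (weight (s b) - weight (r b)) +
      (weight (s c) - weight (r c)) := by
  have h1 : ∑ v, (weight (s v) - weight (r v)) =
      ∑ v ∈ insert u (insert a (insert b {c})), (weight (s v) - weight (r v)) := by
    symm
    refine Finset.sum_subset (Finset.subset_univ _) fun x _ hx => ?_
    simp only [Finset.mem_insert, Finset.mem_singleton, not_or] at hx
    rw [hrs x hx.1 (by rw [h.adj_iff]; tauto), sub_self]
  rw [Finset.sum_insert (by simp [h.adj₁.ne, h.adj₂.ne, h.adj₃.ne]),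
    Finset.sum_insert (by simp [h.ne₁₂, h.ne₁₃]), Finset.sum_insert (by simp [h.ne₂₃]),
    Finset.sum_singleton, Finset.sum_sub_distrib] at h1
  linarith

section Potential

variable [Fintype V] [DecidableRel G.Adj]

variable (G) in
/-- The ordered pairs of adjacent vertices at which `r` takes the value 3. -/
def fullPairs (r : V → ℕ) : Finset (V × V) :=
  Finset.univ.filter fun p => G.Adj p.1 p.2 ∧ r p.1 = 3 ∧ r p.2 = 3

variable (G) in
/-- The potential minimized by the vertex coloring. -/
def potential (r : V → ℕ) : ℤ := ∑ v, weight (r v) + 4 * (G.fullPairs r).card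

lemma mem_fullPairs {r : V → ℕ} {x y : V} :
    (x, y) ∈ G.fullPairs r ↔ G.Adj x y ∧ r x = 3 ∧ r y = 3 := by simp [fullPairs]

lemma card_fullPairs_mono {r s : V → ℕ} (h : ∀ v, s v = 3 → r v = 3) :
    (G.fullPairs s).card ≤ (G.fullPairs r).card := by
  refine Finset.card_le_card fun ⟨x, y⟩ hp => ?_
  rw [mem_fullPairs] at hp ⊢
  exact ⟨hp.1, h _ hp.2.1, h _ hp.2.2⟩

variable [DecidableEq V]

/-- Only `t` can newly acquire the value 3, so a new pair consists of `t` and an element of `S`, in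
either order. -/
lemma card_fullPairs_le {r s : V → ℕ} {t : V} (h : ∀ v, v ≠ t → s v = 3 → r v = 3)
    {S : Finset V} (hS : ∀ v, G.Adj t v → s v = 3 → v ∈ S) :
    (G.fullPairs s).card ≤ (G.fullPairs r).card + 2 * S.card := by
  have hsub : G.fullPairs s ⊆
      G.fullPairs r ∪ (S.image fun y => (t, y)) ∪ (S.image fun y => (y, t)) := by
    rintro ⟨x, y⟩ hp
    rw [mem_fullPairs] at hp
    rcases eq_or_ne x t with rfl | hx
    · simp [hS y hp.1 hp.2.2]
    rcases eq_or_ne y t with rfl | hy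
    · simp [hS x hp.1.symm hp.2.1]
    · simp [mem_fullPairs, hp.1, h x hx hp.2.1, h y hy hp.2.2]
  have h1 := Finset.card_le_card hsub
  have h2 := Finset.card_union_le (G.fullPairs r ∪ (S.image fun y => (t, y)))
    (S.image fun y => (y, t))
  have h3 := Finset.card_union_le (G.fullPairs r) (S.image fun y => (t, y))
  have h4 := Finset.card_image_le (s := S) (f := fun y => (t, y))
  have h5 := Finset.card_image_le (s := S) (f := fun y => (y, t))
  omega

lemma card_fullPairs_add_four_le {r s : V → ℕ} {p a b : V} (h : ∀ v, s v = 3 → r v = 3)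
    (ha : G.Adj p a) (hb : G.Adj p b) (hab : a ≠ b) (hp : s p ≠ 3)
    (hrp : r p = 3) (hra : r a = 3) (hrb : r b = 3) :
    (G.fullPairs s).card + 4 ≤ (G.fullPairs r).card := by
  have hT : ({(p, a), (p, b), (a, p), (b, p)} : Finset (V × V)).card = 4 := by
    rw [Finset.card_insert_of_notMem, Finset.card_insert_of_notMem, Finset.card_insert_of_notMem,
      Finset.card_singleton]
    · simp [hab]
    · simp [ha.ne, hb.ne]
    · simp [hab, ha.ne, hb.ne]
  rw [← hT, ← Finset.card_union_of_disjoint]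
  · refine Finset.card_le_card ?_
    rintro ⟨x, y⟩ hxy
    simp only [Finset.mem_union, mem_fullPairs, Finset.mem_insert, Finset.mem_singleton,
      Prod.mk.injEq] at hxy ⊢
    rcases hxy with hxy | ⟨rfl, rfl⟩ | ⟨rfl, rfl⟩ | ⟨rfl, rfl⟩ | ⟨rfl, rfl⟩
    · exact ⟨hxy.1, h _ hxy.2.1, h _ hxy.2.2⟩
    · exact ⟨ha, hrp, hra⟩
    · exact ⟨hb, hrp, hrb⟩
    · exact ⟨ha.symm, hra, hrp⟩
    · exact ⟨hb.symm, hrb, hrp⟩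
  · rw [Finset.disjoint_left]
    rintro ⟨x, y⟩ hxy
    simp only [mem_fullPairs, Finset.mem_insert, Finset.mem_singleton, Prod.mk.injEq] at hxy ⊢
    rintro (⟨rfl, rfl⟩ | ⟨rfl, rfl⟩ | ⟨rfl, rfl⟩ | ⟨rfl, rfl⟩) <;> simp_all

end Potential

end SimpleGraph

/-! ### Optimal colorings and the flips that would improve them -/

namespace SimpleGraph

variable {V : Type*} {G : SimpleGraph V} [Fintype V] [DecidableRel G.Adj]

variable (G) in
/-- The vertex coloring `f` has no monochromatic cycle, and has the least potential among such
colorings. -/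
structure IsOptimal (f : V → Bool) : Prop where
  isAcyclic : (G.monoGraph f).IsAcyclic
  potential_le : ∀ g : V → Bool, (G.monoGraph g).IsAcyclic →
    G.potential (G.crossDegree f) ≤ G.potential (G.crossDegree g)

/-- A maximum cut has all cross degrees at least 2, so its `monoGraph` is a matching. Thus the
finite set of candidates is nonempty. -/
lemma IsRegularOfDegree.exists_isOptimal [DecidableEq V] (hG : G.IsRegularOfDegree 3) :
    ∃ f : V → Bool, G.IsOptimal f := by
  obtain ⟨f₀, -, hmax⟩ := Finset.exists_max_image (Finset.univ : Finset (V → Bool))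
    (fun f => ∑ v, (G.crossDegree f v : ℤ)) ⟨fun _ => true, by simp⟩
  have h2 : ∀ v, 2 ≤ G.crossDegree f₀ v := by
    intro u
    by_contra hlt
    have hm := hmax (flip f₀ u) (Finset.mem_univ _)
    obtain ⟨a, b, c, h⟩ := hG.exists_isNbrTriple' u
    have key : ∑ v, ((G.crossDegree (flip f₀ u) v : ℤ) - G.crossDegree f₀ v) =
        ∑ v ∈ insert u (insert a (insert b {c})),
          ((G.crossDegree (flip f₀ u) v : ℤ) - G.crossDegree f₀ v) := by
      symm
      refine Finset.sum_subset (Finset.subset_univ _) fun x _ hx => ?_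
      simp only [Finset.mem_insert, Finset.mem_singleton, not_or] at hx
      rw [crossDegree_flip_of_not_adj (by rw [h.adj_iff]; tauto) hx.1, sub_self]
    rw [Finset.sum_insert (by simp [h.adj₁.ne, h.adj₂.ne, h.adj₃.ne]),
      Finset.sum_insert (by simp [h.ne₁₂, h.ne₁₃]), Finset.sum_insert (by simp [h.ne₂₃]),
      Finset.sum_singleton, Finset.sum_sub_distrib] at key
    have hu := hG.crossDegree_flip_self f₀ u
    have hd : ∀ x, G.Adj u x → (G.crossDegree (flip f₀ u) x : ℤ) - G.crossDegree f₀ x =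
        1 - 2 * (if f₀ x ≠ f₀ u then 1 else 0) := by
      intro x hx
      split_ifs with hc
      · have := crossDegree_flip_of_ne hx hc
        omega
      · have := crossDegree_flip_of_eq hx (not_not.1 hc)
        omega
    rw [hd a h.adj₁, hd b h.adj₂, hd c h.adj₃] at key
    have he := crossDegree_eq (f := f₀) h
    split_ifs at key he <;> omega
  have hac : (G.monoGraph f₀).IsAcyclic := isAcyclic_of_subsingleton_neighbors fun v x y hx hy => by
    by_contra hxy
    have := hG.crossDegree_le_one hx hy hxy
    have := h2 v
    omega
  obtain ⟨f, hf, hmin⟩ := (Set.toFinite {g : V → Bool | (G.monoGraph g).IsAcyclic}).exists_minimalFor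
    (fun g => G.potential (G.crossDegree g)) _ ⟨f₀, hac⟩
  exact ⟨f, hf, fun g hg => (le_total _ _).elim id (hmin hg)⟩

lemma IsRegularOfDegree.not_reachable_of_three (hG : G.IsRegularOfDegree 3) {f : V → Bool} {x y : V}
    (hx : G.crossDegree f x = 3) (hxy : x ≠ y) : ¬ (G.monoGraph f).Reachable x y := by
  rintro ⟨w⟩
  cases w with
  | nil => exact hxy rfl
  | cons h _ => exact hG.color_ne_of_crossDegree_eq_three hx h.1 h.2.symm

lemma weight_zero : weight 0 = 504 := rfl
lemma weight_one : weight 1 = 0 := rfl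
lemma weight_two : weight 2 = 103 := rfl
lemma weight_three : weight 3 = 400 := rfl

lemma weight_nonneg (n : ℕ) : 0 ≤ weight n := by unfold weight; split <;> simp

variable [DecidableEq V]

/-- Flip `p`. Its neighbors `a` and `b` are isolated in `monoGraph`, so no cycle arises. -/
lemma IsOptimal.false_of_three (hG : G.IsRegularOfDegree 3) {f : V → Bool} (hf : G.IsOptimal f)
    {p a b : V} (ha : G.Adj p a) (hb : G.Adj p b) (hab : a ≠ b) (hp3 : G.crossDegree f p = 3)
    (ha3 : G.crossDegree f a = 3) (hb3 : G.crossDegree f b = 3) : False := by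
  obtain ⟨c, h⟩ := hG.exists_isNbrTriple ha hb hab
  have hac : (G.monoGraph (flip f p)).IsAcyclic := by
    refine isAcyclic_monoGraph_flip hf.isAcyclic fun x y hx _ hy _ hxy => ?_
    rw [h.adj_iff] at hx hy
    rcases hx with rfl | rfl | rfl
    · exact hG.not_reachable_of_three ha3 hxy
    · exact hG.not_reachable_of_three hb3 hxy
    · rw [reachable_comm]
      rcases hy with rfl | rfl | rfl
      · exact hG.not_reachable_of_three ha3 hxy.symm
      · exact hG.not_reachable_of_three hb3 hxy.symm
      · exact absurd rfl hxy
  have hle := hf.potential_le _ hac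
  have hadj : ∀ x, G.Adj p x → G.crossDegree (flip f p) x + 1 = G.crossDegree f x := fun x hx =>
    crossDegree_flip_of_ne hx (hG.color_ne_of_crossDegree_eq_three hp3 hx)
  have hself := hG.crossDegree_flip_self f p
  have hmono : ∀ v, G.crossDegree (flip f p) v = 3 → G.crossDegree f v = 3 := by
    intro v hv
    by_cases hpv : G.Adj p v
    · have := hadj v hpv; have := hG.crossDegree_le f v; omega
    · rcases eq_or_ne v p with rfl | hne
      · exact hp3
      · rwa [crossDegree_flip_of_not_adj hpv hne] at hv
  have hE := card_fullPairs_add_four_le hmono ha hb hab (by omega) hp3 ha3 hb3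
  have hW := sum_weight_eq (r := G.crossDegree f) (s := G.crossDegree (flip f p)) h
    fun v hv hv' => crossDegree_flip_of_not_adj hv' hv
  have e1 : G.crossDegree (flip f p) p = 0 := by omega
  have e2 : G.crossDegree (flip f p) a = 2 := by have := hadj a ha; omega
  have e3 : G.crossDegree (flip f p) b = 2 := by have := hadj b hb; omega
  have e4 : weight (G.crossDegree (flip f p) c) - weight (G.crossDegree f c) ≤ 504 := by
    have hc := hadj c h.adj₃
    have := weight_nonneg (G.crossDegree f c)
    have hle : ∀ n, weight n ≤ 504 := by intro n; unfold weight; split <;> simp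
    have := hle (G.crossDegree (flip f p) c)
    omega
  -- The change is +104 at `p`, -297 at each of `a` and `b`, at most +504 at `c`, and at most -16
  -- from the four lost ordered pairs: at most -2 in all.
  rw [e1, e2, e3, hp3, ha3, hb3, weight_zero, weight_two, weight_three] at hW
  unfold potential at hle
  omega

/-- Flipping a vertex of cross degree 2 whose neighbors of the other color lie in distinct
components and have cross degree at least 2 is an improvement, but for one case. -/
lemma IsOptimal.of_not_reachable (hG : G.IsRegularOfDegree 3) {f : V → Bool} (hf : G.IsOptimal f)
    {u v v' t y y' : V} (h : G.IsNbrTriple u v v' t) (ht : G.IsNbrTriple t y y' u)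
    (hfv : f v ≠ f u) (hfv' : f v' ≠ f u) (hft : f t = f u) (hv : 2 ≤ G.crossDegree f v)
    (hv' : 2 ≤ G.crossDegree f v') (hr : ¬ (G.monoGraph f).Reachable v v') :
    G.crossDegree f v = 2 ∧ G.crossDegree f y = 3 ∧ G.crossDegree f y' = 3 := by
  have hac : (G.monoGraph (flip f u)).IsAcyclic := by
    refine isAcyclic_monoGraph_flip hf.isAcyclic fun x y hx hfx hy hfy hxy => ?_
    rw [h.adj_iff] at hx hy
    rcases hx with rfl | rfl | rfl
    · rcases hy with rfl | rfl | rfl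
      · exact absurd rfl hxy
      · exact hr
      · exact absurd hft hfy
    · rcases hy with rfl | rfl | rfl
      · rwa [reachable_comm]
      · exact absurd rfl hxy
      · exact absurd hft hfy
    · exact absurd hft hfx
  have hle := hf.potential_le _ hac
  have hu : G.crossDegree f u = 2 := by rw [crossDegree_eq h]; simp [hfv, hfv', hft]
  have e1 : G.crossDegree (flip f u) u = 1 := by have := hG.crossDegree_flip_self f u; omega
  have ev := crossDegree_flip_of_ne h.adj₁ hfv
  have ev' := crossDegree_flip_of_ne h.adj₂ hfv'
  have et := crossDegree_flip_of_eq h.adj₃ hft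
  have lv := hG.crossDegree_le f v
  have lv' := hG.crossDegree_le f v'
  have lt : G.crossDegree f t ≤ 2 := hG.crossDegree_le_two (v := u) ⟨h.adj₃.symm, hft⟩
  have hW := sum_weight_eq (r := G.crossDegree f) (s := G.crossDegree (flip f u)) h
    fun v hv hv' => crossDegree_flip_of_not_adj hv' hv
  have hI : ∀ x, x ≠ t → G.crossDegree (flip f u) x = 3 → G.crossDegree f x = 3 := by
    intro x hxt hx
    rcases eq_or_ne x u with rfl | hxu
    · omega
    by_cases hux : G.Adj u x
    · rcases (h.adj_iff x).1 hux with rfl | rfl | rfl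
      · omega
      · omega
      · exact absurd rfl hxt
    · rwa [crossDegree_flip_of_not_adj hux hxu] at hx
  -- Only `t` can rise to cross degree 3, so each new full pair joins `t` to `y` or `y'`.
  have hE := card_fullPairs_le hI (S := ({y, y'} : Finset V).filter fun x => G.crossDegree f x = 3)
    fun x hx h3 => by
      rcases (ht.adj_iff x).1 hx with rfl | rfl | rfl
      · simp [hI _ hx.ne' h3]
      · simp [hI _ hx.ne' h3]
      · omega
  rw [Finset.card_filter, Finset.sum_pair ht.ne₁₂] at hE
  have hE' : G.crossDegree f t ≤ 1 → (G.fullPairs (G.crossDegree (flip f u))).card ≤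
      (G.fullPairs (G.crossDegree f)).card := fun h1 =>
    card_fullPairs_mono fun x hx => hI x (by rintro rfl; omega) hx
  have dv : ∀ x, G.crossDegree (flip f u) x + 1 = G.crossDegree f x → 2 ≤ G.crossDegree f x →
      G.crossDegree f x ≤ 3 →
      (G.crossDegree f x = 2 ∧
        weight (G.crossDegree (flip f u) x) - weight (G.crossDegree f x) = -103) ∨
      (G.crossDegree f x = 3 ∧
        weight (G.crossDegree (flip f u) x) - weight (G.crossDegree f x) = -297) := by
    intro x h1 h2 h3
    rw [← h1] at h2 h3 ⊢
    generalize G.crossDegree (flip f u) x = m at *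
    have : m = 1 ∨ m = 2 := by omega
    rcases this with rfl | rfl <;> simp [weight]
  have dt : (G.crossDegree f t ≤ 1 ∧
        weight (G.crossDegree (flip f u) t) - weight (G.crossDegree f t) ≤ 103) ∨
      (G.crossDegree f t = 2 ∧
        weight (G.crossDegree (flip f u) t) - weight (G.crossDegree f t) = 297) := by
    rw [et]
    generalize G.crossDegree f t = n at *
    interval_cases n <;> simp [weight]
  rw [e1, hu, weight_one, weight_two] at hW
  unfold potential at hle
  -- With `v` and `v'` of cross degree 2 and `t` rising from 2 to 3, the weights change by -3·103 +
  -- 297 = -12. Each of `y`, `y'` of cross degree 3 adds at most 8, so both are needed to avoid an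
  -- improvement. All other cases improve outright.
  rcases dt with ⟨h1, dt⟩ | ⟨h1, dt⟩
  · have := hE' h1
    rcases dv v ev hv lv with ⟨_, d1⟩ | ⟨_, d1⟩ <;>
      rcases dv v' ev' hv' lv' with ⟨_, d2⟩ | ⟨_, d2⟩ <;> omega
  · rcases dv v ev hv lv with ⟨_, d1⟩ | ⟨_, d1⟩ <;>
      rcases dv v' ev' hv' lv' with ⟨_, d2⟩ | ⟨_, d2⟩ <;> split_ifs at hE <;> omega

/-- If both neighbors of the other color of a vertex of cross degree 2 have cross degree at
least 2, then they are in the same component of the monochromatic graph. -/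
lemma IsOptimal.reachable (hG : G.IsRegularOfDegree 3) {f : V → Bool} (hf : G.IsOptimal f)
    {u v v' t : V} (h : G.IsNbrTriple u v v' t) (hfv : f v ≠ f u) (hfv' : f v' ≠ f u)
    (hft : f t = f u) (hv : 2 ≤ G.crossDegree f v) (hv' : 2 ≤ G.crossDegree f v') :
    (G.monoGraph f).Reachable v v' := by
  by_contra hr
  obtain ⟨z, htz, hzu⟩ : ∃ z, G.Adj t z ∧ z ≠ u := by
    obtain ⟨x, y, z, ht⟩ := hG.exists_isNbrTriple' t
    rcases eq_or_ne x u with rfl | hx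
    exacts [⟨y, ht.adj₂, ht.ne₁₂.symm⟩, ⟨x, ht.adj₁, hx⟩]
  obtain ⟨y, ht⟩ := hG.exists_isNbrTriple htz h.adj₃.symm hzu
  have ht : G.IsNbrTriple t z y u :=
    ⟨fun x => by rw [ht.adj_iff]; tauto, ht.ne₁₃, ht.ne₁₂, ht.ne₂₃.symm⟩
  obtain ⟨-, hz3, hy3⟩ := hf.of_not_reachable hG h ht hfv hfv' hft hv hv' hr
  -- Now exchange `u` and `t`: the opposite neighbors `z` and `y` of `t` have cross degree 3, hence
  -- are isolated in `monoGraph`. The same exception would require `z` to have cross degree 2.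
  have := hf.of_not_reachable hG ht h (hG.color_ne_of_crossDegree_eq_three hz3 ht.adj₁.symm).symm
    (hG.color_ne_of_crossDegree_eq_three hy3 ht.adj₂.symm).symm hft.symm (by omega) (by omega)
    (hG.not_reachable_of_three hz3 ht.ne₁₂)
  omega

/-- Flipping `p` alone could close a cycle through `v` and `v'`; flipping `b` cuts their connection.
The gain at `p` pays for the flip of `b`. -/
lemma IsOptimal.false_of_double_flip (hG : G.IsRegularOfDegree 3) {f : V → Bool}
    (hf : G.IsOptimal f) {p v v' t b : V} (h : G.IsNbrTriple p v v' t) (hfv : f v ≠ f p)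
    (hfv' : f v' ≠ f p) (hft : f t = f p) (hv : G.crossDegree f v = 2)
    (hv' : G.crossDegree f v' = 2) (ht : G.crossDegree f t ≤ 1) (hb : G.crossDegree f b = 0)
    (hfb : f b = f v) (hnb : ∀ x, G.Adj b x → G.crossDegree f x ≤ 1 ∨ x = v ∨ x = v')
    (hr : ¬ (G.monoGraph (flip f b)).Reachable v v') : False := by
  have hbp : b ≠ p := by rintro rfl; exact hfv hfb.symm
  have hbcol : ∀ x, G.Adj b x → f x = f b := fun x hx =>
    color_eq_of_crossDegree_eq_zero hb hx
  have hbp' : ¬ G.Adj b p := fun hc => hfv (by rw [← hfb, hbcol p hc])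
  have hbt : b ≠ t := by rintro rfl; exact hfv (hfb.symm.trans hft)
  have hacb : (G.monoGraph (flip f b)).IsAcyclic :=
    isAcyclic_monoGraph_flip hf.isAcyclic fun x y hx hfx => absurd (hbcol x hx) hfx
  have hac : (G.monoGraph (flip (flip f p) b)).IsAcyclic := by
    -- Acyclicity takes `b` first, so that `v` and `v'` are separated before `p` joins them. The
    -- potential is computed with `p` first, so that `v` and `v'` have dropped to cross degree 1
    -- before `b` is flipped.
    rw [flip_comm]
    refine isAcyclic_monoGraph_flip hacb fun x y hx hfx hy hfy hxy => ?_
    have hxb : x ≠ b := by rintro rfl; exact hbp' hx.symm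
    have hyb : y ≠ b := by rintro rfl; exact hbp' hy.symm
    rw [flip_of_ne _ hxb, flip_of_ne _ hbp.symm] at hfx
    rw [flip_of_ne _ hyb, flip_of_ne _ hbp.symm] at hfy
    rw [h.adj_iff] at hx hy
    rcases hx with rfl | rfl | rfl
    · rcases hy with rfl | rfl | rfl
      · exact absurd rfl hxy
      · exact hr
      · exact absurd hft hfy
    · rcases hy with rfl | rfl | rfl
      · rwa [reachable_comm]
      · exact absurd rfl hxy
      · exact absurd hft hfy
    · exact absurd hft hfx
  have hle := hf.potential_le _ hac
  -- the flip of `p`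
  have hp : G.crossDegree f p = 2 := by rw [crossDegree_eq h]; simp [hfv, hfv', hft]
  have ep : G.crossDegree (flip f p) p = 1 := by have := hG.crossDegree_flip_self f p; omega
  have ev : G.crossDegree (flip f p) v = 1 := by
    have := crossDegree_flip_of_ne h.adj₁ hfv; omega
  have ev' : G.crossDegree (flip f p) v' = 1 := by
    have := crossDegree_flip_of_ne h.adj₂ hfv'; omega
  have et := crossDegree_flip_of_eq h.adj₃ hft
  have dt : weight (G.crossDegree (flip f p) t) - weight (G.crossDegree f t) ≤ 103 := by
    rw [et]
    generalize G.crossDegree f t = n at *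
    interval_cases n <;> simp [weight]
  have hW := sum_weight_eq (r := G.crossDegree f) (s := G.crossDegree (flip f p)) h
    fun v hv hv' => crossDegree_flip_of_not_adj hv' hv
  have hE : (G.fullPairs (G.crossDegree (flip f p))).card ≤
      (G.fullPairs (G.crossDegree f)).card := card_fullPairs_mono fun x hx => by
    by_cases hpx : G.Adj p x
    · rcases (h.adj_iff x).1 hpx with rfl | rfl | rfl <;> omega
    · rcases eq_or_ne x p with rfl | hne
      · omega
      · rwa [crossDegree_flip_of_not_adj hpx hne] at hx
  rw [ep, ev, ev', hp, hv, hv', weight_one, weight_two] at hW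
  -- the flip of `b`
  set g := flip f p with hg
  have gb : G.crossDegree g b = 0 := by
    rw [hg, crossDegree_flip_of_not_adj (fun hc => hbp' hc.symm) hbp, hb]
  have gnb : ∀ x, G.Adj b x → G.crossDegree g x ≤ 1 := by
    intro x hx
    rcases hnb x hx with h1 | rfl | rfl
    · have hxp : x ≠ p := by rintro rfl; exact hbp' hx
      by_cases hpx : G.Adj p x
      · rcases (h.adj_iff x).1 hpx with rfl | rfl | rfl
        · omega
        · omega
        · exact absurd ((hft.symm.trans (hbcol _ hx)).trans hfb).symm hfv
      · rwa [hg, crossDegree_flip_of_not_adj hpx hxp]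
    · omega
    · omega
  have eb : G.crossDegree (flip g b) b = 3 := by have := hG.crossDegree_flip_self g b; omega
  have enb : ∀ x, G.Adj b x → G.crossDegree (flip g b) x = G.crossDegree g x + 1 := fun x hx =>
    crossDegree_flip_of_eq hx (color_eq_of_crossDegree_eq_zero gb hx)
  have dnb : ∀ x, G.Adj b x →
      weight (G.crossDegree (flip g b) x) - weight (G.crossDegree g x) ≤ 103 := by
    intro x hx
    rw [enb x hx]
    have := gnb x hx
    generalize G.crossDegree g x = n at *
    interval_cases n <;> simp [weight]
  obtain ⟨x, y, z, hx⟩ := hG.exists_isNbrTriple' b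
  have hW' := sum_weight_eq (r := G.crossDegree g) (s := G.crossDegree (flip g b)) hx
    fun v hv hv' => crossDegree_flip_of_not_adj hv' hv
  have hE' := card_fullPairs_le (G := G) (r := G.crossDegree g) (s := G.crossDegree (flip g b))
    (t := b) (S := ∅) (fun w hwb hw => by
      by_cases hbw : G.Adj b w
      · have := enb w hbw; have := gnb w hbw; omega
      · rwa [crossDegree_flip_of_not_adj hbw hwb] at hw)
    (fun w hbw hw => by have := enb w hbw; have := gnb w hbw; omega)
  have d1 := dnb x hx.adj₁
  have d2 := dnb y hx.adj₂
  have d3 := dnb z hx.adj₃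
  -- The flip of `p` changes the weights by at most -3·103 + 103 = -206, and that of `b` by at most
  -- -104 + 3·103 = 205. Neither adds a full pair, so the total is at most -1.
  rw [eb, gb, weight_zero, weight_three] at hW'
  rw [Finset.card_empty] at hE'
  unfold potential at hle
  omega

end SimpleGraph

/-! ### Girth and the exclusion of alternating paths -/

namespace SimpleGraph

variable {V : Type*} {G : SimpleGraph V}

lemma not_adj_of_four_le_egirth (h : 4 ≤ G.egirth) {a b c : V} (hab : G.Adj a b) (hbc : G.Adj b c) :
    ¬ G.Adj c a := by
  intro hca
  let C : G.Walk a a := .cons hab (.cons hbc (.cons hca .nil))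
  have hC : C.IsCycle := by
    simp [C, Walk.cons_isCycle_iff, Walk.cons_isPath_iff, hab.ne', hbc.ne, hca.ne, hca.ne',
      hab.ne]
  have := h.trans (le_egirth.1 le_rfl a C hC)
  simp only [C, Walk.length_cons, Walk.length_nil] at this
  exact absurd this (by decide)

lemma not_adj_of_seven_le_egirth (h : 7 ≤ G.egirth) {a b c d e x : V} (hab : G.Adj a b)
    (hbc : G.Adj b c) (hcd : G.Adj c d) (hde : G.Adj d e) (hex : G.Adj e x)
    (hnd : [a, b, c, d, e, x].Nodup) : ¬ G.Adj x a := by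
  intro hxa
  let C : G.Walk a a := .cons hab (.cons hbc (.cons hcd (.cons hde (.cons hex (.cons hxa .nil)))))
  have hC : C.IsCycle := by
    simp only [List.nodup_cons, List.mem_cons, List.not_mem_nil, or_false, not_or] at hnd
    simp only [C, Walk.cons_isCycle_iff, Walk.cons_isPath_iff, Walk.support_cons, Walk.support_nil,
      Walk.edges_cons, Walk.edges_nil, List.mem_cons, Sym2.eq_iff, List.not_mem_nil, Walk.IsPath.nil]
    grind
  have := h.trans (le_egirth.1 le_rfl a C hC)
  simp only [C, Walk.length_cons, Walk.length_nil] at this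
  exact absurd this (by decide)

variable [Fintype V] [DecidableRel G.Adj]

/-- Both `b` and the next vertex from `x` toward `a` are monochromatic neighbors of `x`. -/
lemma IsRegularOfDegree.crossDegree_le_one_of_dist (hG : G.IsRegularOfDegree 3) {f : V → Bool}
    {a b x : V} (hr : (G.monoGraph f).Reachable a x) (hx : (G.monoGraph f).Adj b x)
    (hd : (G.monoGraph f).dist a x + 1 = (G.monoGraph f).dist a b) (hxa : a ≠ x) :
    G.crossDegree f x ≤ 1 := by
  obtain ⟨y, hy, hy'⟩ := hr.exists_adj_dist_add_one hxa
  exact hG.crossDegree_le_one hy hx.symm (by rintro rfl; omega)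

lemma IsRegularOfDegree.crossDegree_le_two_of_reachable (hG : G.IsRegularOfDegree 3) {f : V → Bool}
    {x y : V} (h : (G.monoGraph f).Reachable x y) (hxy : x ≠ y) : G.crossDegree f x ≤ 2 := by
  by_contra hc
  have := hG.crossDegree_le f x
  exact hG.not_reachable_of_three (by omega) hxy h

/-- A monochromatic path from `u` to `w` must start through `t` and go on, giving `t` a second
monochromatic neighbor. -/
lemma IsRegularOfDegree.crossDegree_le_one_of_leaf (hG : G.IsRegularOfDegree 3) {f : V → Bool}
    {u v v' t w : V} (h : G.IsNbrTriple u v v' t) (hfv : f v ≠ f u) (hfv' : f v' ≠ f u)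
    (hr : (G.monoGraph f).Reachable w u) (hwu : w ≠ u) (hwt : w ≠ t) : G.crossDegree f t ≤ 1 := by
  obtain ⟨x, hx, hx'⟩ := hr.exists_adj_dist_add_one hwu
  have hxt : x = t := by
    rcases (h.adj_iff x).1 hx.1 with rfl | rfl | rfl
    · exact absurd hx.2.symm hfv
    · exact absurd hx.2.symm hfv'
    · rfl
  subst hxt
  exact hG.crossDegree_le_one_of_dist (hr.trans hx.reachable) hx hx' hwt

/-- In an optimal coloring, no path of length 6 alternates in color. -/
lemma IsOptimal.false_of_alternating_path [DecidableEq V] (hG : G.IsRegularOfDegree 3)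
    (hgirth : 7 ≤ G.egirth) {f : V → Bool} (hf : G.IsOptimal f) {p : ℕ → V}
    (hinj : ∀ i j, i ≤ 6 → j ≤ 6 → p i = p j → i = j) (hadj : ∀ i < 6, G.Adj (p i) (p (i + 1)))
    (halt : ∀ i < 6, f (p i) ≠ f (p (i + 1))) : False := by
  have hne : ∀ i j, i ≤ 6 → j ≤ 6 → i ≠ j → p i ≠ p j := fun i j hi hj hij h =>
    hij (hinj i j hi hj h)
  have h2 : ∀ i < 5, 2 ≤ G.crossDegree f (p (i + 1)) := fun i hi =>
    two_le_crossDegree (hadj i (by omega)).symm (halt i (by omega)) (hadj (i + 1) (by omega))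
      (halt (i + 1) (by omega)).symm (hne _ _ (by omega) (by omega) (by omega))
  have htriple : ∀ i < 5, G.crossDegree f (p (i + 1)) = 2 →
      ∃ t, G.IsNbrTriple (p (i + 1)) (p i) (p (i + 2)) t ∧ f t = f (p (i + 1)) := fun i hi h =>
    hG.exists_of_crossDegree_eq_two h (hadj i (by omega)).symm (hadj (i + 1) (by omega))
      (hne _ _ (by omega) (by omega) (by omega)) (halt i (by omega)) (halt (i + 1) (by omega)).symm
  have hreach : ∀ i, 1 ≤ i → i ≤ 3 → G.crossDegree f (p (i + 1)) = 2 →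
      (G.monoGraph f).Reachable (p i) (p (i + 2)) := by
    intro i hi hi' h
    obtain ⟨t, ht, hft⟩ := htriple i (by omega) h
    obtain ⟨j, rfl⟩ := Nat.exists_eq_add_of_le' hi
    exact hf.reachable hG ht (halt _ (by omega)) (halt _ (by omega)).symm hft (h2 j (by omega))
      (h2 (j + 2) (by omega))
  have hle2 : ∀ {i j}, i < 5 → j < 5 → i ≠ j →
      (G.monoGraph f).Reachable (p (i + 1)) (p (j + 1)) → G.crossDegree f (p (i + 1)) = 2 :=
    fun {i j} hi hj hij h => le_antisymm
      (hG.crossDegree_le_two_of_reachable h (hne _ _ (by omega) (by omega) (by omega))) (h2 i hi)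
  -- If p3 had cross degree 3, it would be isolated in `monoGraph`. Then p2 and p4 could not have
  -- cross degree 2, as this would connect p3 to p1 or p5; so three consecutive vertices would have
  -- cross degree 3.
  have c3 : G.crossDegree f (p 3) = 2 := by
    by_contra hc
    have h3 : ∀ i < 5, G.crossDegree f (p (i + 1)) ≠ 2 → G.crossDegree f (p (i + 1)) = 3 :=
      fun i hi h => by
        have := h2 i hi; have := hG.crossDegree_le f (p (i + 1)); omega
    by_cases c2 : G.crossDegree f (p 2) = 2
    · exact hc (hle2 (i := 2) (j := 0) (by omega) (by omega) (by omega)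
        (hreach 1 (by omega) (by omega) c2).symm)
    by_cases c4 : G.crossDegree f (p 4) = 2
    · exact hc (hle2 (i := 2) (j := 4) (by omega) (by omega) (by omega)
        (hreach 3 (by omega) (by omega) c4))
    exact hf.false_of_three hG (hadj 2 (by omega)).symm (hadj 3 (by omega))
      (hne 2 4 (by omega) (by omega) (by omega)) (h3 2 (by omega) hc) (h3 1 (by omega) c2)
      (h3 3 (by omega) c4)
  have r24 := hreach 2 (by omega) (by omega) c3
  have c2 : G.crossDegree f (p 2) = 2 := hle2 (i := 1) (j := 3) (by omega) (by omega) (by omega) r24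
  have c4 : G.crossDegree f (p 4) = 2 :=
    hle2 (i := 3) (j := 1) (by omega) (by omega) (by omega) r24.symm
  have r13 := hreach 1 (by omega) (by omega) c2
  have r35 := hreach 3 (by omega) (by omega) c4
  have c1 : G.crossDegree f (p 1) = 2 := hle2 (i := 0) (j := 2) (by omega) (by omega) (by omega) r13
  have c5 : G.crossDegree f (p 5) = 2 :=
    hle2 (i := 4) (j := 2) (by omega) (by omega) (by omega) r35.symm
  have hn42 : ¬ G.Adj (p 4) (p 2) := not_adj_of_four_le_egirth (le_trans (by decide) hgirth)
    (hadj 2 (by omega)) (hadj 3 (by omega))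
  obtain ⟨t, ht, hft⟩ := htriple 1 (by omega) c2
  obtain ⟨s, hs, hfs⟩ := htriple 3 (by omega) c4
  have hct : G.crossDegree f t ≤ 1 := hG.crossDegree_le_one_of_leaf ht (halt 1 (by omega))
    (halt 2 (by omega)).symm r24.symm (hne 4 2 (by omega) (by omega) (by omega))
    (by rintro h; exact hn42 (h ▸ ht.adj₃.symm))
  have hcs : G.crossDegree f s ≤ 1 := hG.crossDegree_le_one_of_leaf hs (halt 3 (by omega))
    (halt 4 (by omega)).symm r24 (hne 2 4 (by omega) (by omega) (by omega))
    (by rintro h; exact hn42 (h ▸ hs.adj₃))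
  -- Cross degree 2 makes p1, p3, p5 leaves of `monoGraph`, and they lie in one component.
  obtain ⟨m, x, hx, ham, hmx, hax, hd⟩ := exists_median (M := G.monoGraph f)
    (a := fun i : Fin 3 => p (2 * i + 1))
    (fun i j hij => by have := hinj _ _ (by omega) (by omega) hij; omega)
    (by
      have r15 := r13.trans r35
      intro i j
      fin_cases i <;> fin_cases j <;> simp <;>
        first | assumption | (apply Reachable.symm; assumption))
    (by
      intro i y z hy hz
      by_contra hyz
      have := hG.crossDegree_le_one hy hz hyz
      fin_cases i <;> simp at this <;> omega)
  have hm : G.IsNbrTriple m (x 0) (x 1) (x 2) := by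
    obtain ⟨c, hc⟩ := hG.exists_isNbrTriple (hmx 0).1 (hmx 1).1 (hx.ne (by decide))
    rcases (hc.adj_iff (x 2)).1 (hmx 2).1 with h | h | h
    · exact absurd h (hx.ne (by decide))
    · exact absurd h (hx.ne (by decide))
    · rwa [h]
  have hm0 : G.crossDegree f m = 0 := by
    rw [crossDegree_eq hm]
    simp [← (hmx 0).2, ← (hmx 1).2, ← (hmx 2).2]
  have hmcol : ∀ i : Fin 3, f m = f (p (2 * i + 1)) := fun i =>
    ((hax i).trans (hmx i).symm.reachable).color_eq.symm
  have hcx : ∀ i : Fin 3, G.crossDegree f (x i) ≤ 1 ∨ x i = p (2 * i + 1) := fun i => by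
    rcases eq_or_ne (p (2 * i + 1)) (x i) with h | h
    · exact Or.inr h.symm
    · exact Or.inl (hG.crossDegree_le_one_of_dist (hax i) (hmx i) (hd i) h)
  have hiso : ∀ y, ¬ (G.monoGraph (flip f m)).Adj m y := fun y hy => by
    rw [monoGraph_flip_adj_self] at hy
    exact hy.2 (color_eq_of_crossDegree_eq_zero hm0 hy.1)
  have hsub : G.monoGraph (flip f m) ≤ G.monoGraph f := fun y z hyz => by
    have hy : y ≠ m := by rintro rfl; exact hiso _ hyz
    have hz : z ≠ m := by rintro rfl; exact hiso _ hyz.symm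
    exact (monoGraph_flip_adj_of_ne hy hz).1 hyz
  have hnr : ∀ i j : Fin 3, i ≠ j →
      ¬ (G.monoGraph (flip f m)).Reachable (p (2 * i + 1)) (p (2 * j + 1)) := by
    intro i j hij hr
    have key : ∀ k : Fin 3, (G.monoGraph (flip f m)).Reachable (p (2 * k + 1)) (x k) := fun k =>
      (hax k).of_dist_lt (u := m) (fun y z hy hz h => (monoGraph_flip_adj_of_ne hy hz).2 h)
        (by have := hd k; omega)
    exact hf.isAcyclic.not_reachable_of_isolated hsub hiso (hmx i) (hmx j) (hx.ne hij)
      ((key i).symm.trans (hr.trans (key j)))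
  have hnb : ∀ y, G.Adj m y → y = x 0 ∨ y = x 1 ∨ y = x 2 := fun y => (hm.adj_iff y).1
  have h0 := hcx 0
  have h1 := hcx 1
  have h2' := hcx 2
  simp at h0 h1 h2'
  -- The double flip at p2 needs cross degree at most 1 at `x 2`, which can fail only if `x 2` is
  -- p5. Then p4 serves instead, because `x 0` = p1 would give the 6-cycle p1 p2 p3 p4 p5 m.
  by_cases h5 : x 2 = p 5
  · have hx1 : x 0 ≠ p 1 := by
      intro h1
      refine not_adj_of_seven_le_egirth hgirth (hadj 1 (by omega)) (hadj 2 (by omega))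
        (hadj 3 (by omega)) (hadj 4 (by omega)) (h5 ▸ (hmx 2).1.symm) ?_ (h1 ▸ (hmx 0).1)
      have e1 := ham 0
      have e3 := ham 1
      have e5 := ham 2
      have e2 : p 2 ≠ m := by
        rintro h; exact halt 1 (by omega) (by rw [h, hmcol 0]; rfl)
      have e4 : p 4 ≠ m := by
        rintro h; exact halt 3 (by omega) (by rw [h, hmcol 1]; rfl)
      simp at e1 e3 e5
      simp [e1, e2, e3, e4, e5, hne]
    refine hf.false_of_double_flip hG hs (halt 3 (by omega)) (halt 4 (by omega)).symm hfs c3 c5 hcs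
      hm0 (hmcol 1) ?_ (hnr 1 2 (by decide))
    rintro y hy
    rcases hnb y hy with rfl | rfl | rfl
    · exact Or.inl (h0.resolve_right hx1)
    · exact h1.imp_right Or.inl
    · exact h2'.imp_right Or.inr
  · refine hf.false_of_double_flip hG ht (halt 1 (by omega)) (halt 2 (by omega)).symm hft c1 c3 hct
      hm0 (hmcol 0) ?_ (hnr 0 1 (by decide))
    rintro y hy
    rcases hnb y hy with rfl | rfl | rfl
    · exact h0.imp_right Or.inl
    · exact h1.imp_right Or.inr
    · exact Or.inl (h2'.resolve_right h5)

end SimpleGraph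

/-! ### From vertex colorings to edge colorings, and the lower bound -/

namespace SimpleGraph

variable {V : Type*} {G : SimpleGraph V}

/-- In a forest, every neighbor of a vertex farthest from a root is strictly closer to the root. So
two such neighbors would stay connected without that vertex, closing a cycle. -/
lemma IsRegularOfDegree.not_isAcyclic [Fintype V] [Nonempty V] [DecidableRel G.Adj]
    (hG : G.IsRegularOfDegree 3) : ¬ G.IsAcyclic := by
  classical
  intro hac
  obtain ⟨r⟩ := ‹Nonempty V›
  obtain ⟨v, hv, hmax⟩ := Finset.exists_max_image (Finset.univ.filter fun v => G.Reachable r v)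
    (fun v => G.dist r v) ⟨r, by simp⟩
  simp only [Finset.mem_filter, Finset.mem_univ, true_and] at hv hmax
  obtain ⟨x, y, z, h⟩ := hG.exists_isNbrTriple' v
  have hlt : ∀ w, G.Adj v w → (G.deleteIncidenceSet v).Reachable r w := fun w hw =>
    (hv.trans hw.reachable).of_dist_lt (u := v)
      (fun a b ha hb hab => (G.deleteIncidenceSet_adj).2 ⟨hab, ha, hb⟩)
      (lt_of_le_of_ne (hmax w (hv.trans hw.reachable)) (hac.dist_ne_of_adj hw (hv)).symm)
  exact hac.not_reachable_of_isolated (G.deleteIncidenceSet_le v)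
    (fun w hw => (G.deleteIncidenceSet_adj.1 hw).2.1 rfl) h.adj₁ h.adj₂ h.ne₁₂
    ((hlt x h.adj₁).symm.trans (hlt y h.adj₂))

/-- Every edge of a cycle is the first edge of a cycle with the same edges. -/
lemma Walk.IsCycle.exists_cons {v : V} {C : G.Walk v v} (hC : C.IsCycle) {e : Sym2 V}
    (he : e ∈ C.edges) : ∃ (x y : V) (h : G.Adj x y) (w : G.Walk y x), e = s(x, y) ∧
      (Walk.cons h w).IsCycle ∧ (∀ e' ∈ (Walk.cons h w).edges, e' ∈ C.edges) := by
  classical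
  induction e with | _ x y =>
  have hx := C.fst_mem_support_of_mem_edges he
  have hmem : ∀ e', e' ∈ (C.rotate x hx).edges ↔ e' ∈ C.edges := fun e' =>
    (C.rotate_edges x hx).mem_iff
  have hD := hC.rotate hx
  generalize C.rotate x hx = D at hD hmem
  have hy : y ∈ D.toSubgraph.neighborSet x := by
    rw [Subgraph.mem_neighborSet, Walk.adj_toSubgraph_iff_mem_edges, hmem]
    exact he
  have key : ∀ D : G.Walk x x, D.IsCycle → (∀ e', e' ∈ D.edges ↔ e' ∈ C.edges) → y = D.snd →
      ∃ (x' y' : V) (h : G.Adj x' y') (w : G.Walk y' x'), s(x, y) = s(x', y') ∧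
        (Walk.cons h w).IsCycle ∧ (∀ e' ∈ (Walk.cons h w).edges, e' ∈ C.edges) := by
    intro D hD hmem hy
    refine ⟨x, D.snd, D.adj_snd hD.not_nil, D.tail, by rw [hy], ?_, fun e' => ?_⟩
    · rwa [D.cons_tail_eq hD.not_nil]
    · rw [D.cons_tail_eq hD.not_nil]; exact (hmem e').1
  rw [hD.neighborSet_toSubgraph_endpoint] at hy
  rcases hy with hy | hy
  · exact key D hD hmem hy
  · refine key D.reverse hD.reverse (by simpa using hmem) ?_
    rw [Walk.snd_reverse]
    exact hy

open Classical in
/-- The edge coloring given by whether the ends of an edge have the same color under `f`. -/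
noncomputable def cutLabeling (G : SimpleGraph V) (f : V → Bool) : G.EdgeLabeling (Fin 2) :=
  fun e => if e.1 ∈ (G.monoGraph f).edgeSet then 0 else 1

lemma cutLabeling_eq_iff {f : V → Bool} {e e' : G.edgeSet} :
    G.cutLabeling f e = G.cutLabeling f e' ↔
      (e.1 ∈ (G.monoGraph f).edgeSet ↔ e'.1 ∈ (G.monoGraph f).edgeSet) := by
  unfold cutLabeling
  split_ifs <;> simp_all

lemma IsOptimal.isStronglyWoody_cutLabeling [Fintype V] [DecidableRel G.Adj]
    (hG : G.IsRegularOfDegree 3) (hgirth : 7 ≤ G.egirth)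
    {f : V → Bool} (hf : G.IsOptimal f) : (G.cutLabeling f).IsStronglyWoody := by
  classical
  rintro B ⟨v, C, hC, e, he, rfl⟩ hmono
  obtain ⟨x, y, h, w, rfl, hw, hsub⟩ := hC.exists_cons he
  have hlen : 7 ≤ (Walk.cons h w).length :=
    ENat.natCast_le_natCast.1 (hgirth.trans (le_egirth.1 le_rfl _ _ hw))
  rw [Walk.length_cons] at hlen
  obtain ⟨hwp, hwe⟩ := Walk.cons_isCycle_iff w h |>.1 hw
  have hB : ∀ e' ∈ w.edges, e' ∈ (C.toSubgraph.deleteEdges {s(x, y)}).edgeSet := by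
    intro e' he'
    have hne : e' ≠ s(x, y) := by rintro rfl; exact hwe he'
    have hC' := C.mem_edges_toSubgraph.2 (hsub e' (by simp [he']))
    induction e' with | _ a b =>
    exact Subgraph.mem_edgeSet.2 ((Subgraph.deleteEdges_adj ..).2 ⟨hC', hne⟩)
  have hsame : ∀ e₁ ∈ w.edges, ∀ e₂ ∈ w.edges,
      (e₁ ∈ (G.monoGraph f).edgeSet ↔ e₂ ∈ (G.monoGraph f).edgeSet) := fun e₁ h₁ e₂ h₂ =>
    cutLabeling_eq_iff.1 (hmono ⟨e₁, w.edges_subset_edgeSet h₁⟩ ⟨e₂, w.edges_subset_edgeSet h₂⟩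
      (hB e₁ h₁) (hB e₂ h₂))
  have hedge : ∀ i < w.length, s(w.getVert i, w.getVert (i + 1)) ∈ w.edges := fun i hi =>
    Walk.adj_toSubgraph_iff_mem_edges.1 (w.toSubgraph_adj_getVert hi)
  by_cases h0 : s(w.getVert 0, w.getVert 1) ∈ (G.monoGraph f).edgeSet
  · have hall : ∀ e' ∈ w.edges, e' ∈ (G.monoGraph f).edgeSet := fun e' he' =>
      (hsame e' he' _ (hedge 0 (by omega))).2 h0
    have hyx : (G.monoGraph f).Reachable y x := ⟨w.transfer _ hall⟩
    refine hf.isAcyclic _ (hw.transfer (H := G.monoGraph f) fun e' he' => ?_)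
    rw [Walk.edges_cons, List.mem_cons] at he'
    rcases he' with rfl | he'
    · exact ⟨h, hyx.color_eq.symm⟩
    · exact hall e' he'
  -- Here no edge of the path is monochromatic, so its first seven vertices alternate in color.
  · refine hf.false_of_alternating_path hG hgirth (p := w.getVert)
      (fun i j hi hj hij => hwp.getVert_injOn (Set.mem_ofPred_eq ▸ by omega)
        (Set.mem_ofPred_eq ▸ by omega) hij)
      (fun i hi => w.adj_getVert_succ (by omega)) fun i hi heq => h0 ?_
    rw [hsame _ (hedge 0 (by omega)) _ (hedge i (by omega))]
    exact ⟨w.adj_getVert_succ (by omega), heq⟩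

end SimpleGraph

theorem mainTheorem9 {V : Type*} [Fintype V] [Nonempty V] (G : SimpleGraph V)
    [DecidableRel G.Adj] (hcubic : G.IsRegularOfDegree 3) (hgirth : 7 ≤ G.egirth) :
    G.strongArboricity = 2 := by
  classical
  refine le_antisymm ?_ (le_iInf₂ fun n ⟨c, hc⟩ => ?_)
  · obtain ⟨f, hf⟩ := hcubic.exists_isOptimal
    exact iInf₂_le 2 ⟨_, hf.isStronglyWoody_cutLabeling hcubic hgirth⟩
  · by_contra hn
    have hn : n ≤ 1 := by
      have : (n : ℕ∞) < (2 : ℕ) := not_le.1 hn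
      have := ENat.natCast_lt_natCast.1 this
      omega
    have : Subsingleton (Fin n) := Fin.subsingleton_iff_le_one.2 hn
    have hac := hcubic.not_isAcyclic
    simp only [SimpleGraph.IsAcyclic, not_forall, not_not] at hac
    obtain ⟨v, C, hC⟩ := hac
    obtain ⟨e, he⟩ := C.edges.exists_mem_of_ne_nil (by simp [hC.not_nil])
    exact hc _ ⟨v, C, hC, e, he, rfl⟩ fun _ _ _ _ => Subsingleton.elim _ _
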